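/- Let $\mathcal X,\mathcal Y$ be measurable spaces, let $\ell:\mathcal Y\times\mathcal Y\to[0,1]$ be a measurable pseudometric loss, and let $\mathcal H\subseteq\mathcal Y^{\mathcal X}$. A learner $A$ maps every finite labeled sample to a predictor $\mathcal X\to\mathcal Y$; it is measurable if $(S,(x,y))\mapsto\ell(A(S)(x),y)$ is measurable for every sample size. A sample $S=((x_i,y_i))_{i\le n}$ is realizable if some $h\in\mathcal H$ has $y_i=h(x_i)$ for all $i$, and a probability distribution $\mathcal D$ on $\mathcal X\times\mathcal Y$ is realizable if some $h\in\mathcal H$ has $y=h(x)$ $\mathcal D$-almost surely. Write $L_{\mathcal D}(h)=\mathbb E_{(x,y)\sim\mathcal D}[\ell(h(x),y)]$ (an upper expectation if the loss of $h$ is not measurable) and $L^{\mathrm{Trans}}_S(A)=\frac1n\sum_{i=1}^n\ell(A(S_{-i})(x_i),y_i)$, where $S_{-i}$ is $S$ without its $i$-th point. Let $m_{\mathrm{Trans},\mathcal H}(\epsilon)$ be the least $n$ for which some measurable learner $A$ satisfies $L^{\mathrm{Trans}}_S(A)\le\epsilon$ for all realizable samples $S$ of size at least $n$. Let $m_{\mathrm{PAC},\mathcal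 H}(\epsilon,\delta)$ be the least $n$ for which some learner $A$ satisfies $\Pr_{S\sim\mathcal D^m}[L_{\mathcal D}(A(S))>\epsilon]\le\delta$ for all $m\ge n$ and all realizable $\mathcal D$ (an outer probability if the event is not measurable). Both are $\infty$ if there is no such $n$. **Theorem.** For all $\epsilon>0$ and $\delta\in(0,1)$, $$m_{\mathrm{PAC},\mathcal H}(\epsilon,\delta)\;\le\; m_{\mathrm{Trans},\mathcal H}(\epsilon/8)+\frac{24}{\epsilon}\log\frac2\delta .$$ If $(\mathcal Y,\ell)$ is separable, the bound also holds when only measurable learners are admitted in the definition of $m_{\mathrm{PAC},\mathcal H}$. Moreover, medians of transductive learners trained on nested prefixes achieve such a guarantee: let $A$ be a measurable learner whose output does not depend on the order of the sample, with $L^{\mathrm{Trans}}_S(A)\le\epsilon/8$ for all realizable samples $S$ of size at least $n$, and let $k\ge\frac{24}{\epsilon}\log\frac2\delta$ be an integer. Given $S\in(\mathcal X\times\mathcal Y)^{n+k}$, let $h_i=A(S_i)$ for $0\le i<k$, where $S_i$ consists of the first $n+i$ points of $S$, and let $\hat h_S$ be any predictor such that for every $x$ the label $\hat h_S(x)$ is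 a metric median of $h_0(x),\dots,h_{k-1}(x)$, that is, a minimizer of $y\mapsto\sum_{i<k}\ell(h_i(x),y)$ over $\mathcal Y$. Then $\Pr_{S\sim\mathcal D^{n+k}}[L_{\mathcal D}(\hat h_S)>\epsilon]\le\delta$ for every realizable $\mathcal D$. -/

import Mathlib

open MeasureTheory

open scoped ENNReal

namespace RealizableLearning

/-- A (pseudo)metric loss with values in `[0,1]`. -/
structure IsBoundedPseudometric {Y : Type*} (ℓ : Y → Y → ℝ) : Prop where
  nonneg : ∀ y y', 0 ≤ ℓ y y'
  le_one : ∀ y y', ℓ y y' ≤ 1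
  self_eq_zero : ∀ y, ℓ y y = 0
  symm : ∀ y y', ℓ y y' = ℓ y' y
  triangle : ∀ y y' y'', ℓ y y'' ≤ ℓ y y' + ℓ y' y''

/-- The label space has a countable dense set for the loss. -/
def IsSeparableLoss {Y : Type*} (ℓ : Y → Y → ℝ) : Prop :=
  ∃ t : Set Y, t.Countable ∧ ∀ y : Y, ∀ η : ℝ, 0 < η → ∃ u ∈ t, ℓ u y < η

/-- A learner maps a labeled sample, of any finite size, to a predictor. -/
abbrev Learner (X Y : Type*) : Type _ :=
  (n : ℕ) → (Fin n → X × Y) → X → Y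

/-- The loss incurred on a test point is a measurable function of the training sample and
the test point. -/
def Learner.IsMeasurable {X Y : Type*} [MeasurableSpace X] [MeasurableSpace Y]
    (ℓ : Y → Y → ℝ) (A : Learner X Y) : Prop :=
  ∀ n : ℕ, Measurable fun p : (Fin n → X × Y) × (X × Y) => ℓ (A n p.1 p.2.1) p.2.2

/-- The predictor does not depend on the order of the training sample. -/
def Learner.IsSymmetric {X Y : Type*} (A : Learner X Y) : Prop :=
  ∀ (n : ℕ) (π : Equiv.Perm (Fin n)) (S : Fin n → X × Y), A n (S ∘ π) = A n S

/-- The distributional error `L_D(h)`, the expected loss of `h` on a test point drawn from `D`.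
It is written as an upper expectation, so that it is meaningful for every function `h`; by
`risk_eq_lintegral` it is the ordinary expectation as soon as the loss of `h` is measurable. -/
noncomputable def risk {X Y : Type*} [MeasurableSpace X] [MeasurableSpace Y]
    (ℓ : Y → Y → ℝ) (D : Measure (X × Y)) (h : X → Y) : ℝ≥0∞ :=
  ⨅ (g : X × Y → ℝ≥0∞) (_ : Measurable g) (_ : ∀ z, ENNReal.ofReal (ℓ (h z.1) z.2) ≤ g z),
    ∫⁻ z, g z ∂D

theorem risk_eq_lintegral {X Y : Type*} [MeasurableSpace X] [MeasurableSpace Y]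
    (ℓ : Y → Y → ℝ) (D : Measure (X × Y)) (h : X → Y)
    (hm : Measurable fun z : X × Y => ℓ (h z.1) z.2) :
    risk ℓ D h = ∫⁻ z, ENNReal.ofReal (ℓ (h z.1) z.2) ∂D := by
  apply le_antisymm
  · exact iInf_le_of_le _ (iInf_le_of_le hm.ennreal_ofReal (iInf_le_of_le (fun _ => le_rfl) le_rfl))
  · exact le_iInf fun g => le_iInf fun _ => le_iInf fun hg => lintegral_mono hg

/-- `D` is consistent with a hypothesis in `H`: `y = h(x)` almost surely. -/
def IsRealizableDist {X Y : Type*} [MeasurableSpace X] [MeasurableSpace Y]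
    (H : Set (X → Y)) (D : Measure (X × Y)) : Prop :=
  ∃ h ∈ H, ∀ᵐ z ∂D, z.2 = h z.1

/-- The sample `S` is consistent with a hypothesis in `H`. -/
def IsRealizableSample {X Y : Type*} (H : Set (X → Y)) {n : ℕ} (S : Fin n → X × Y) : Prop :=
  ∃ h ∈ H, ∀ i, (S i).2 = h (S i).1

/-- The transductive (leave-one-out) error of `A` on a sample of size `m + 1`. -/
noncomputable def transError {X Y : Type*} (ℓ : Y → Y → ℝ) (A : Learner X Y) {m : ℕ}
    (S : Fin (m + 1) → X × Y) : ℝ :=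
  (1 / ((m : ℝ) + 1)) * ∑ i : Fin (m + 1), ℓ (A m (fun j => S (i.succAbove j)) (S i).1) (S i).2

/-- `A` has transductive error at most `ε` on all realizable samples of size at least `n`.
The best hypothesis has error `0` on a realizable sample, so there is no benchmark term. -/
def TransLearns {X Y : Type*} (ℓ : Y → Y → ℝ) (H : Set (X → Y)) (A : Learner X Y)
    (ε : ℝ) (n : ℕ) : Prop :=
  ∀ m : ℕ, n ≤ m + 1 → ∀ S : Fin (m + 1) → X × Y, IsRealizableSample H S → transError ℓ A S ≤ ε

/-- For every realizable distribution and every sample size at least `n`, the error of the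
learned predictor exceeds `ε` with probability at most `δ`.
(The value of a measure on a set that is not measurable is its outer measure.)
The best hypothesis has error `0` for a realizable `D`, so there is no benchmark term. -/
def PACLearns {X Y : Type*} [MeasurableSpace X] [MeasurableSpace Y]
    (ℓ : Y → Y → ℝ) (H : Set (X → Y)) (A : Learner X Y) (ε δ : ℝ) (n : ℕ) : Prop :=
  ∀ m : ℕ, n ≤ m → ∀ D : Measure (X × Y), IsProbabilityMeasure D → IsRealizableDist H D →
    (Measure.pi fun _ : Fin m => D) {S | ENNReal.ofReal ε < risk ℓ D (A m S)} ≤ ENNReal.ofReal δ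

/-- The transductive sample complexity `m_Trans(ε)` over the class `𝒜` of learners; it is `⊤`
if no learner of the class reaches the error `ε`. -/
noncomputable def transSampleComplexity {X Y : Type*} (𝒜 : Set (Learner X Y))
    (ℓ : Y → Y → ℝ) (H : Set (X → Y)) (ε : ℝ) : ℕ∞ :=
  ⨅ (n : ℕ) (_ : ∃ A ∈ 𝒜, TransLearns ℓ H A ε n), (n : ℕ∞)

/-- The PAC sample complexity `m_PAC(ε, δ)` over the class `𝒜` of learners; it is `⊤`
if no learner of the class reaches the error `ε` with confidence `1 - δ`. -/
noncomputable def pacSampleComplexity {X Y : Type*} [MeasurableSpace X] [MeasurableSpace Y]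
    (𝒜 : Set (Learner X Y)) (ℓ : Y → Y → ℝ) (H : Set (X → Y)) (ε δ : ℝ) : ℕ∞ :=
  ⨅ (n : ℕ) (_ : ∃ A ∈ 𝒜, PACLearns ℓ H A ε δ n), (n : ℕ∞)

/-- `y` is a metric median of `v`: it minimizes the total loss to the labels `v i`. -/
def IsMedian {Y : Type*} (ℓ : Y → Y → ℝ) {k : ℕ} (v : Fin k → Y) (y : Y) : Prop :=
  ∀ y' : Y, ∑ i, ℓ (v i) y ≤ ∑ i, ℓ (v i) y'

/-- The first `n + i` points of a sample of size `n + k`. -/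
def samplePrefix {X Y : Type*} {n k : ℕ} (S : Fin (n + k) → X × Y) (i : Fin k) :
    Fin (n + i) → X × Y :=
  fun j => S (Fin.castLE (Nat.add_le_add_left i.isLt.le n) j)

/-- `B` predicts, at every point `x`, a metric median of the predictions `h_0(x), …, h_{k-1}(x)`,
where `h_i` is learned by `A` from the first `n + i` points of the sample. -/
def IsMedianOfPrefixes {X Y : Type*} (ℓ : Y → Y → ℝ) (A : Learner X Y) (n k : ℕ)
    (B : (Fin (n + k) → X × Y) → X → Y) : Prop :=
  ∀ (S : Fin (n + k) → X × Y) (x : X),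
    IsMedian ℓ (fun i : Fin k => A (n + i) (samplePrefix S i) x) (B S x)

end RealizableLearning

/-! Put `q = ε / 8`. Train a symmetric learner on the first `n + i` points and test it on the next
one. Given the unordered sample, the test point is uniform among the points, so the leave-one-out
bound controls the observed loss `Λ_i`. Peeling off points from the end gives `E ∏ 2 ^ Λ_i ≤ (1 + q)
^ k` (`lintegral_prefixProd_mul_le`). Read forwards, with `r_i` the risk of the `i`-th predictor, `∏
2 ^ (-Λ_i) * exp (r_i / 2)` is a supermartingale (`lintegral_prefixProd_half_rpow_le`). The product
of the two is `exp (∑ r_i / 2)`, so Markov's inequality for each bounds the total risk by `7/2 * k *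
q` outside probability `2 * exp (-k * q / 3)` (`measure_sum_risk_le`).

By the triangle inequality a median of the predictions has at most twice their average loss
(`risk_le_of_totalLoss_le`). This aggregates them into one predictor without any convexity.

A learner that depends on the order is replaced by its average over all orderings. That average is a
randomized learner, but the argument only uses its expected loss. Exact minimizers may fail to exist
or to be measurable; near-minimizers suffice. -/

namespace RealizableLearning

/-! ### Exchangeability and products along an i.i.d. sample -/

/-- Removing a coordinate from an i.i.d. sample leaves an i.i.d. sample and an independent
test point. -/
theorem lintegral_pi_succAbove {Z : Type*} [MeasurableSpace Z] (D : Measure Z)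
    [IsProbabilityMeasure D] {m : ℕ} (i : Fin (m + 1)) (f : (Fin m → Z) → Z → ℝ≥0∞)
    (hf : Measurable (Function.uncurry f)) :
    ∫⁻ S, f (fun j => S (i.succAbove j)) (S i) ∂(Measure.pi fun _ : Fin (m + 1) => D) =
      ∫⁻ T, ∫⁻ z, f T z ∂D ∂(Measure.pi fun _ : Fin m => D) := by
  have h := measurePreserving_piFinSuccAbove (fun _ : Fin (m + 1) => D) i
  have hs : Measurable fun p : Z × (Fin m → Z) => f p.2 p.1 := hf.comp measurable_swap
  have h1 := h.lintegral_comp hs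
  rw [lintegral_prod_symm' _ hs] at h1
  exact h1

/-- The permutation that sends `i` to `j` and acts as `π` on the remaining indices. -/
def permInsert {m : ℕ} (i j : Fin (m + 1)) (π : Equiv.Perm (Fin m)) : Equiv.Perm (Fin (m + 1)) :=
  (finSuccEquiv' i).trans ((Equiv.optionCongr π).trans (finSuccEquiv' j).symm)

@[simp]
theorem permInsert_self {m : ℕ} (i j : Fin (m + 1)) (π : Equiv.Perm (Fin m)) :
    permInsert i j π i = j := by
  simp [permInsert]

@[simp]
theorem permInsert_succAbove {m : ℕ} (i j : Fin (m + 1)) (π : Equiv.Perm (Fin m)) (x : Fin m) :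
    permInsert i j π (i.succAbove x) = j.succAbove (π x) := by
  simp [permInsert]

/-- The product, along the last `k` points of a sample, of `f` evaluated at the preceding points
and the current one. -/
noncomputable def prefixProd {Z : Type*} (f : (m : ℕ) → (Fin m → Z) → Z → ℝ≥0∞) (n : ℕ) :
    (k : ℕ) → (Fin (n + k) → Z) → ℝ≥0∞
  | 0, _ => 1
  | k + 1, S => prefixProd f n k (fun j => S j.castSucc) *
      f (n + k) (fun j => S j.castSucc) (S (Fin.last (n + k)))

theorem measurable_prefixProd {Z : Type*} [MeasurableSpace Z]
    {f : (m : ℕ) → (Fin m → Z) → Z → ℝ≥0∞} (hf : ∀ m, Measurable (Function.uncurry (f m)))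
    (n k : ℕ) : Measurable (prefixProd f n k) := by
  induction k with
  | zero => exact measurable_const
  | succ k ih =>
    have h0 : Measurable fun (S : Fin (n + k + 1) → Z) (j : Fin (n + k)) => S j.castSucc :=
      measurable_pi_lambda _ fun j => measurable_pi_apply _
    exact (ih.comp h0).mul ((hf (n + k)).comp (h0.prodMk (measurable_pi_apply _)))

theorem lintegral_pi_last {Z : Type*} [MeasurableSpace Z] (D : Measure Z)
    [IsProbabilityMeasure D] {m : ℕ} (f : (Fin m → Z) → Z → ℝ≥0∞)
    (hf : Measurable (Function.uncurry f)) :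
    ∫⁻ S, f (fun j => S j.castSucc) (S (Fin.last m)) ∂(Measure.pi fun _ : Fin (m + 1) => D) =
      ∫⁻ T, ∫⁻ z, f T z ∂D ∂(Measure.pi fun _ : Fin m => D) := by
  simpa using lintegral_pi_succAbove D (Fin.last m) f hf

/-- A product of factors with conditional expectation at most one given the past has expectation
at most one. -/
theorem lintegral_prefixProd_le_one {Z : Type*} [MeasurableSpace Z] (D : Measure Z)
    [IsProbabilityMeasure D] {f : (m : ℕ) → (Fin m → Z) → Z → ℝ≥0∞}
    (hf : ∀ m, Measurable (Function.uncurry (f m))) (h1 : ∀ m S, ∫⁻ z, f m S z ∂D ≤ 1)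
    (n k : ℕ) : ∫⁻ S, prefixProd f n k S ∂(Measure.pi fun _ : Fin (n + k) => D) ≤ 1 := by
  induction k with
  | zero => simp [prefixProd]
  | succ k ih =>
    have hm : Measurable (Function.uncurry fun (T : Fin (n + k) → Z) z =>
        prefixProd f n k T * f (n + k) T z) :=
      ((measurable_prefixProd hf n k).comp measurable_fst).mul (hf (n + k))
    calc _ = ∫⁻ T, ∫⁻ z, prefixProd f n k T * f (n + k) T z ∂D
          ∂(Measure.pi fun _ : Fin (n + k) => D) := lintegral_pi_last D _ hm
      _ ≤ ∫⁻ T, prefixProd f n k T ∂(Measure.pi fun _ : Fin (n + k) => D) := by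
        refine lintegral_mono fun T => ?_
        have hT : Measurable (f (n + k) T) := (hf (n + k)).comp measurable_prodMk_left
        rw [lintegral_const_mul _ hT]
        exact mul_le_of_le_one_right' (h1 _ _)
      _ ≤ 1 := ih

/-- A product of symmetric factors with leave-one-out averages at most `C` has expectation at most
`C ^ k`, also when weighted by a symmetric function. -/
theorem lintegral_prefixProd_mul_le {Z : Type*} [MeasurableSpace Z] (D : Measure Z)
    [IsProbabilityMeasure D] {f : (m : ℕ) → (Fin m → Z) → Z → ℝ≥0∞}
    (hf : ∀ m, Measurable (Function.uncurry (f m)))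
    (hsymm : ∀ m (π : Equiv.Perm (Fin m)) S z, f m (S ∘ π) z = f m S z) (C : ℝ≥0∞) (n : ℕ)
    (hC : ∀ m, n ≤ m → ∀ᵐ S ∂(Measure.pi fun _ : Fin (m + 1) => D),
      ∑ i, f m (fun j => S (i.succAbove j)) (S i) ≤ ((m + 1 : ℕ) : ℝ≥0∞) * C)
    (k : ℕ) (g : (Fin (n + k) → Z) → ℝ≥0∞) (hg : Measurable g)
    (hgs : ∀ (π : Equiv.Perm (Fin (n + k))) S, g (S ∘ π) = g S) :
    ∫⁻ S, prefixProd f n k S * g S ∂(Measure.pi fun _ : Fin (n + k) => D) ≤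
      C ^ k * ∫⁻ S, g S ∂(Measure.pi fun _ : Fin (n + k) => D) := by
  induction k with
  | zero => simp [prefixProd]
  | succ k ih =>
    let μ : (m : ℕ) → Measure (Fin m → Z) := fun m => Measure.pi fun _ : Fin m => D
    -- The weight split into past and current point. Symmetry of `g` makes it symmetric in the past
    -- and indifferent to which point is left out.
    let G : (Fin (n + k) → Z) → Z → ℝ≥0∞ := fun T z => g (Fin.snoc (α := fun _ => Z) T z)
    have hsn : Measurable fun p : (Fin (n + k) → Z) × Z =>
        (Fin.snoc (α := fun _ => Z) p.1 p.2 : Fin (n + k + 1) → Z) := by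
      refine measurable_pi_lambda _ fun j => ?_
      refine Fin.lastCases ?_ (fun j => ?_) j
      · simpa using measurable_snd
      · simpa using (by fun_prop : Measurable fun p : (Fin (n + k) → Z) × Z => p.1 j)
    have hGm : Measurable (Function.uncurry G) := hg.comp hsn
    have hGs : ∀ (π : Equiv.Perm (Fin (n + k))) T z, G (T ∘ π) z = G T z := by
      intro π T z
      refine Eq.trans (congrArg g ?_) (hgs (permInsert (Fin.last (n + k)) (Fin.last (n + k)) π) _)
      funext j
      refine Fin.lastCases ?_ (fun j => ?_) j
      · simp
      · have := permInsert_succAbove (Fin.last (n + k)) (Fin.last (n + k)) π j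
        simp only [Fin.succAbove_last] at this
        simp [this]
    have hGg : ∀ (i : Fin (n + k + 1)) (S : Fin (n + k + 1) → Z),
        G (fun j => S (i.succAbove j)) (S i) = g S := by
      intro i S
      refine Eq.trans (congrArg g ?_) (hgs (permInsert (Fin.last (n + k)) i 1) S)
      funext j
      refine Fin.lastCases ?_ (fun j => ?_) j
      · simp
      · have := permInsert_succAbove (Fin.last (n + k)) i 1 j
        simp only [Fin.succAbove_last] at this
        simp [this]
    have hfG : Measurable (Function.uncurry fun T z => f (n + k) T z * G T z) :=
      (hf (n + k)).mul hGm
    have hP := measurable_prefixProd hf n k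
    have step : ∫⁻ S, prefixProd f n (k + 1) S * g S ∂(μ (n + k + 1)) ≤
        C ^ k * ∫⁻ T, ∫⁻ z, f (n + k) T z * G T z ∂D ∂(μ (n + k)) := by
      have e1 : ∫⁻ S, prefixProd f n (k + 1) S * g S ∂(μ (n + k + 1)) =
          ∫⁻ T, ∫⁻ z, prefixProd f n k T * (f (n + k) T z * G T z) ∂D ∂(μ (n + k)) := by
        rw [← lintegral_pi_last D _ ((hP.comp measurable_fst).mul hfG)]
        refine lintegral_congr fun S => ?_
        have := hGg (Fin.last (n + k)) S
        simp only [Fin.succAbove_last] at this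
        rw [this, prefixProd, mul_assoc]
      rw [e1]
      -- Integrating out the last point leaves a symmetric function of the past, which is an
      -- admissible weight for the induction hypothesis. This is why the statement carries `g`.
      refine le_trans (le_of_eq ?_) (ih (fun T => ∫⁻ z, f (n + k) T z * G T z ∂D)
        hfG.lintegral_prod_right' (fun π T => ?_))
      · refine lintegral_congr fun T => ?_
        exact lintegral_const_mul _ (hfG.comp measurable_prodMk_left)
      · simp only [hsymm, hGs]
    -- By exchangeability any index can play the last point; summing over all of them produces the
    -- leave-one-out sum, with the common factor `g S`.
    have loo : ((n + k + 1 : ℕ) : ℝ≥0∞) *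
        ∫⁻ T, ∫⁻ z, f (n + k) T z * G T z ∂D ∂(μ (n + k)) ≤
        ((n + k + 1 : ℕ) : ℝ≥0∞) * (C * ∫⁻ S, g S ∂(μ (n + k + 1))) := by
      have e2 : ((n + k + 1 : ℕ) : ℝ≥0∞) *
          ∫⁻ T, ∫⁻ z, f (n + k) T z * G T z ∂D ∂(μ (n + k)) =
          ∑ i : Fin (n + k + 1), ∫⁻ S, f (n + k) (fun j => S (i.succAbove j)) (S i) * g S
            ∂(μ (n + k + 1)) := by
        rw [← nsmul_eq_mul, ← Fin.sum_const]
        refine Finset.sum_congr rfl fun i _ => ?_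
        rw [← lintegral_pi_succAbove D i _ hfG]
        exact lintegral_congr fun S => by rw [hGg]
      have hfi : ∀ i : Fin (n + k + 1), Measurable fun S : Fin (n + k + 1) → Z =>
          f (n + k) (fun j => S (i.succAbove j)) (S i) * g S := fun i =>
        ((hf (n + k)).comp (by fun_prop : Measurable fun S : Fin (n + k + 1) → Z =>
          ((fun j => S (i.succAbove j)), S i))).mul hg
      rw [e2, ← lintegral_finsetSum _ fun i _ => hfi i, ← mul_assoc]
      refine le_trans (lintegral_mono_ae ?_) (lintegral_const_mul _ hg).le
      filter_upwards [hC (n + k) (Nat.le_add_right n k)] with S hS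
      rw [← Finset.sum_mul]
      gcongr
    have loo' := (ENNReal.mul_le_mul_iff_right (by simp) (by simp)).1 loo
    refine step.trans ?_
    rw [pow_succ, mul_assoc]
    exact mul_le_mul_right loo' (C ^ k)

/-! ### Concentration of the risks of a randomized symmetric learner -/

/-- A symmetric measurable randomized learner, represented by the expected distance `Λ m S (x, y)`
between its prediction at `x` and the label `y`. -/
structure IsSoftLearner {X Y : Type*} [MeasurableSpace X] [MeasurableSpace Y] (ℓ : Y → Y → ℝ)
    (Λ : (m : ℕ) → (Fin m → X × Y) → X × Y → ℝ) : Prop where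
  measurable : ∀ m, Measurable (Function.uncurry (Λ m))
  symm : ∀ m (π : Equiv.Perm (Fin m)) S z, Λ m (S ∘ π) z = Λ m S z
  nonneg : ∀ m S z, 0 ≤ Λ m S z
  le_one : ∀ m S z, Λ m S z ≤ 1
  -- The triangle inequality in two forms: `le_add` serves the approximation by a dense sequence of
  -- labels, `loss_le` the comparison with a median.
  le_add : ∀ m S x y y', Λ m S (x, y) ≤ Λ m S (x, y') + ℓ y' y
  loss_le : ∀ m S x y y', ℓ y y' ≤ Λ m S (x, y) + Λ m S (x, y')

/-- The leave-one-out error of a randomized learner is at most `q` on realizable samples. -/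
def SoftTransLearns {X Y : Type*} (H : Set (X → Y))
    (Λ : (m : ℕ) → (Fin m → X × Y) → X × Y → ℝ) (q : ℝ) (n : ℕ) : Prop :=
  ∀ m, n ≤ m → ∀ S : Fin (m + 1) → X × Y, IsRealizableSample H S →
    ∑ i, Λ m (fun j => S (i.succAbove j)) (S i) ≤ ((m : ℝ) + 1) * q

theorem sum_samplePrefix_succ {X Y : Type*} (φ : (m : ℕ) → (Fin m → X × Y) → ℝ) (n k : ℕ)
    (S : Fin (n + (k + 1)) → X × Y) :
    ∑ i : Fin (k + 1), φ (n + i) (samplePrefix S i) =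
      ∑ i : Fin k, φ (n + i) (samplePrefix (fun j : Fin (n + k) => S j.castSucc) i) +
        φ (n + k) (fun j => S j.castSucc) := by
  rw [Fin.sum_univ_castSucc]
  rfl

theorem ae_isRealizableSample {X Y : Type*} [MeasurableSpace X] [MeasurableSpace Y]
    {H : Set (X → Y)} {D : Measure (X × Y)} [IsProbabilityMeasure D] (hD : IsRealizableDist H D)
    (m : ℕ) : ∀ᵐ S ∂(Measure.pi fun _ : Fin m => D), IsRealizableSample H S := by
  obtain ⟨h, hH, hh⟩ := hD
  have : ∀ᵐ S ∂(Measure.pi fun _ : Fin m => D), ∀ i, (S i).2 = h (S i).1 :=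
    ae_all_iff.2 fun i => (Measure.quasiMeasurePreserving_eval (fun _ : Fin m => D) i).ae hh
  filter_upwards [this] with S hS
  exact ⟨h, hH, hS⟩

theorem measurable_integral_soft {X Y : Type*} [MeasurableSpace X] [MeasurableSpace Y]
    {ℓ : Y → Y → ℝ} {Λ : (m : ℕ) → (Fin m → X × Y) → X × Y → ℝ} (hΛ : IsSoftLearner ℓ Λ)
    (D : Measure (X × Y)) [IsProbabilityMeasure D] (m : ℕ) :
    Measurable fun S => ∫ z, Λ m S z ∂D :=
  ((hΛ.measurable m).stronglyMeasurable.integral_prod_right).measurable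

theorem measurable_half_rpow_mul_exp {X Y : Type*} [MeasurableSpace X] [MeasurableSpace Y]
    {ℓ : Y → Y → ℝ} {Λ : (m : ℕ) → (Fin m → X × Y) → X × Y → ℝ} (hΛ : IsSoftLearner ℓ Λ)
    (D : Measure (X × Y)) [IsProbabilityMeasure D] (m : ℕ) :
    Measurable (Function.uncurry fun (S : Fin m → X × Y) z =>
      ENNReal.ofReal ((2⁻¹ : ℝ) ^ Λ m S z * Real.exp ((∫ z, Λ m S z ∂D) / 2))) := by
  have h1 : Measurable fun p : (Fin m → X × Y) × (X × Y) => (2⁻¹ : ℝ) ^ Λ m p.1 p.2 :=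
    (hΛ.measurable m).const_pow (2⁻¹ : ℝ)
  have h2 : Measurable fun p : (Fin m → X × Y) × (X × Y) =>
      Real.exp ((∫ z, Λ m p.1 z ∂D) / 2) :=
    (((measurable_integral_soft hΛ D m).div_const 2).exp).comp measurable_fst
  exact (h1.mul h2).ennreal_ofReal

theorem integrable_soft {X Y : Type*} [MeasurableSpace X] [MeasurableSpace Y]
    {ℓ : Y → Y → ℝ} {Λ : (m : ℕ) → (Fin m → X × Y) → X × Y → ℝ} (hΛ : IsSoftLearner ℓ Λ)
    (D : Measure (X × Y)) [IsProbabilityMeasure D] (m : ℕ) (S : Fin m → X × Y) :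
    Integrable (Λ m S) D := by
  have hm : Measurable (Λ m S) := (hΛ.measurable m).comp measurable_prodMk_left
  refine Integrable.of_bound hm.aestronglyMeasurable 1 (ae_of_all _ fun z => ?_)
  rw [Real.norm_eq_abs, abs_of_nonneg (hΛ.nonneg _ _ _)]
  exact hΛ.le_one _ _ _

/-- Chernoff bound for the losses suffered online by a symmetric learner on an i.i.d. sample:
the leave-one-out error controls their exponential moment. -/
theorem lintegral_prefixProd_two_rpow_le {X Y : Type*} [MeasurableSpace X] [MeasurableSpace Y]
    {ℓ : Y → Y → ℝ} {H : Set (X → Y)} {Λ : (m : ℕ) → (Fin m → X × Y) → X × Y → ℝ}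
    (hΛ : IsSoftLearner ℓ Λ) {q : ℝ} (hq : 0 ≤ q) {n : ℕ} (hT : SoftTransLearns H Λ q n)
    {D : Measure (X × Y)} [IsProbabilityMeasure D] (hD : IsRealizableDist H D) (k : ℕ) :
    ∫⁻ S, prefixProd (fun m S z => ENNReal.ofReal ((2 : ℝ) ^ Λ m S z)) n k S
      ∂(Measure.pi fun _ : Fin (n + k) => D) ≤ ENNReal.ofReal (Real.exp (k * q)) := by
  have h := lintegral_prefixProd_mul_le D (f := fun m S z => ENNReal.ofReal ((2 : ℝ) ^ Λ m S z))
    (fun m => ((hΛ.measurable m).const_pow 2).ennreal_ofReal)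
    (fun m π S z => by rw [hΛ.symm]) (ENNReal.ofReal (1 + q)) n (fun m hm => ?_) k (fun _ => 1)
    measurable_const (fun _ _ => rfl)
  · simp only [mul_one, lintegral_const, measure_univ] at h
    refine h.trans ?_
    rw [← ENNReal.ofReal_pow (by positivity), Real.exp_nat_mul]
    refine ENNReal.ofReal_le_ofReal (pow_le_pow_left₀ (by positivity) ?_ k)
    linarith [Real.add_one_le_exp q]
  · filter_upwards [ae_isRealizableSample hD (m + 1)] with S hS
    rw [← ENNReal.ofReal_sum_of_nonneg fun i _ => by positivity, ← ENNReal.ofReal_natCast,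
      ← ENNReal.ofReal_mul (by positivity)]
    refine ENNReal.ofReal_le_ofReal ?_
    calc _ ≤ ∑ i, (1 + Λ m (fun j => S (Fin.succAbove i j)) (S i)) :=
          Finset.sum_le_sum fun i _ => by
            -- Bernoulli's inequality for exponents in `[0, 1]`: `2 ^ t ≤ 1 + t`.
            have := rpow_one_add_le_one_add_mul_self (s := 1) (by norm_num)
              (hΛ.nonneg m (fun j => S (Fin.succAbove i j)) (S i)) (hΛ.le_one _ _ _)
            norm_num at this
            exact this
      _ ≤ _ := by
        have := hT m hm S hS
        rw [Finset.sum_add_distrib]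
        simp only [Finset.sum_const, Finset.card_univ, Fintype.card_fin, nsmul_eq_mul]
        push_cast
        linarith

/-- The supermartingale that compares the risks of the online predictors with their observed
losses. -/
theorem lintegral_prefixProd_half_rpow_le {X Y : Type*} [MeasurableSpace X] [MeasurableSpace Y]
    {ℓ : Y → Y → ℝ} {Λ : (m : ℕ) → (Fin m → X × Y) → X × Y → ℝ}
    (hΛ : IsSoftLearner ℓ Λ) (D : Measure (X × Y)) [IsProbabilityMeasure D] (n k : ℕ) :
    ∫⁻ S, prefixProd (fun m S z =>
        ENNReal.ofReal ((2⁻¹ : ℝ) ^ Λ m S z * Real.exp ((∫ z, Λ m S z ∂D) / 2))) n k S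
      ∂(Measure.pi fun _ : Fin (n + k) => D) ≤ 1 := by
  refine lintegral_prefixProd_le_one D (fun m => ?_) (fun m S => ?_) n k
  · exact measurable_half_rpow_mul_exp hΛ D m
  · have hi := integrable_soft hΛ D m S
    have hm : Measurable (Λ m S) := (hΛ.measurable m).comp measurable_prodMk_left
    set r := ∫ z, Λ m S z ∂D with hr
    have hint : Integrable (fun z => (1 - Λ m S z / 2) * Real.exp (r / 2)) D :=
      ((integrable_const 1).sub (hi.div_const 2)).mul_const _
    calc _ ≤ ∫⁻ z, ENNReal.ofReal ((1 - Λ m S z / 2) * Real.exp (r / 2)) ∂D := by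
          refine lintegral_mono fun z => ENNReal.ofReal_le_ofReal ?_
          refine mul_le_mul_of_nonneg_right ?_ (Real.exp_nonneg _)
          -- The same inequality at base one half: `2⁻¹ ^ t ≤ 1 - t / 2`.
          have := rpow_one_add_le_one_add_mul_self (s := -2⁻¹) (by norm_num)
            (hΛ.nonneg m S z) (hΛ.le_one _ _ _)
          norm_num at this ⊢
          linarith
      _ = ENNReal.ofReal ((1 - r / 2) * Real.exp (r / 2)) := by
          rw [← ofReal_integral_eq_lintegral_ofReal hint (ae_of_all _ fun z => ?_)]
          · rw [integral_mul_const, integral_sub (integrable_const 1) (hi.div_const 2),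
              integral_div]
            simp [hr]
          · have := hΛ.le_one m S z
            exact mul_nonneg (by linarith) (Real.exp_nonneg _)
      _ ≤ 1 := by
          rw [ENNReal.ofReal_le_one]
          have h1 : 1 - r / 2 ≤ Real.exp (-(r / 2)) := by
            linarith [Real.add_one_le_exp (-(r / 2))]
          calc _ ≤ Real.exp (-(r / 2)) * Real.exp (r / 2) :=
                mul_le_mul_of_nonneg_right h1 (Real.exp_nonneg _)
            _ = 1 := by rw [← Real.exp_add]; simp

/-- The factors `2 ^ Λ` and `2⁻¹ ^ Λ` cancel, so the observed losses disappear and only the risks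
remain. -/
theorem prefixProd_two_mul_half {X Y : Type*} [MeasurableSpace X] [MeasurableSpace Y]
    (Λ : (m : ℕ) → (Fin m → X × Y) → X × Y → ℝ) (D : Measure (X × Y)) (n k : ℕ)
    (S : Fin (n + k) → X × Y) :
    prefixProd (fun m S z => ENNReal.ofReal ((2 : ℝ) ^ Λ m S z)) n k S *
      prefixProd (fun m S z =>
        ENNReal.ofReal ((2⁻¹ : ℝ) ^ Λ m S z * Real.exp ((∫ z, Λ m S z ∂D) / 2))) n k S =
      ENNReal.ofReal (Real.exp ((∑ i : Fin k, ∫ z, Λ (n + i) (samplePrefix S i) z ∂D) / 2)) := by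
  induction k with
  | zero => simp [prefixProd]
  | succ k ih =>
    rw [sum_samplePrefix_succ (fun m S => ∫ z, Λ m S z ∂D), prefixProd, prefixProd,
      mul_mul_mul_comm, ih, ← ENNReal.ofReal_mul (by positivity),
      ← ENNReal.ofReal_mul (by positivity), add_div, Real.exp_add,
      Real.inv_rpow (by norm_num)]
    congr 1
    field_simp

theorem measure_ge_ofReal_exp_le {Ω : Type*} [MeasurableSpace Ω] (μ : Measure Ω)
    {f : Ω → ℝ≥0∞} (hf : Measurable f) (a b : ℝ) (h : ∫⁻ ω, f ω ∂μ ≤ ENNReal.ofReal (Real.exp b)) :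
    μ {ω | ENNReal.ofReal (Real.exp a) ≤ f ω} ≤ ENNReal.ofReal (Real.exp (b - a)) := by
  have h1 := (mul_meas_ge_le_lintegral hf (ENNReal.ofReal (Real.exp a)) (μ := μ)).trans h
  rw [Real.exp_sub, ENNReal.ofReal_div_of_pos (Real.exp_pos a)]
  rw [ENNReal.le_div_iff_mul_le (Or.inl (by simp [Real.exp_pos])) (Or.inl (by simp)), mul_comm]
  exact h1

/-- With high probability, the average risk of the online predictors of a symmetric learner is
within a constant factor of its leave-one-out error. -/
theorem measure_sum_risk_le {X Y : Type*} [MeasurableSpace X] [MeasurableSpace Y]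
    {ℓ : Y → Y → ℝ} {H : Set (X → Y)} {Λ : (m : ℕ) → (Fin m → X × Y) → X × Y → ℝ}
    (hΛ : IsSoftLearner ℓ Λ) {q : ℝ} (hq : 0 ≤ q) {n : ℕ} (hT : SoftTransLearns H Λ q n)
    {D : Measure (X × Y)} [IsProbabilityMeasure D] (hD : IsRealizableDist H D) (k : ℕ) :
    (Measure.pi fun _ : Fin (n + k) => D)
      {S | 7 / 2 * (k * q) < ∑ i : Fin k, ∫ z, Λ (n + i) (samplePrefix S i) z ∂D} ≤
      ENNReal.ofReal (2 * Real.exp (-(k * q / 3))) := by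
  have hkq : 0 ≤ k * q := by positivity
  set f : (m : ℕ) → (Fin m → X × Y) → X × Y → ℝ≥0∞ :=
    fun m S z => ENNReal.ofReal ((2 : ℝ) ^ Λ m S z)
  set g : (m : ℕ) → (Fin m → X × Y) → X × Y → ℝ≥0∞ := fun m S z =>
    ENNReal.ofReal ((2⁻¹ : ℝ) ^ Λ m S z * Real.exp ((∫ z, Λ m S z ∂D) / 2))
  have hfm : ∀ m, Measurable (Function.uncurry (f m)) := fun m =>
    ((hΛ.measurable m).const_pow 2).ennreal_ofReal
  have hgm : ∀ m, Measurable (Function.uncurry (g m)) :=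
    measurable_half_rpow_mul_exp hΛ D
  -- The thresholds satisfy `11/8 + 3/8 = 7/4`, half of `7/2`, and balance the two tails: since
  -- `11/8 - 1 = 3/8`, both are `exp (-3/8 * k * q)`.
  have h1 := measure_ge_ofReal_exp_le _ (measurable_prefixProd hfm n k) (11 / 8 * (k * q)) (k * q)
    (lintegral_prefixProd_two_rpow_le hΛ hq hT hD k)
  have h2 := measure_ge_ofReal_exp_le _ (measurable_prefixProd hgm n k) (3 / 8 * (k * q)) 0
    ((lintegral_prefixProd_half_rpow_le hΛ D n k).trans (by simp))
  have hsub : {S : Fin (n + k) → X × Y |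
      7 / 2 * (k * q) < ∑ i : Fin k, ∫ z, Λ (n + i) (samplePrefix S i) z ∂D} ⊆
      {S | ENNReal.ofReal (Real.exp (11 / 8 * (k * q))) ≤ prefixProd f n k S} ∪
      {S | ENNReal.ofReal (Real.exp (3 / 8 * (k * q))) ≤ prefixProd g n k S} := by
    intro S hS
    simp only [Set.mem_ofPred_eq, Set.mem_union] at hS ⊢
    by_contra! hc
    have h3 := mul_le_mul' hc.1.le hc.2.le
    rw [prefixProd_two_mul_half, ← ENNReal.ofReal_mul (by positivity), ← Real.exp_add,
      ENNReal.ofReal_le_ofReal_iff (by positivity), Real.exp_le_exp] at h3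
    linarith
  refine (measure_mono hsub).trans ((measure_union_le _ _).trans ((add_le_add h1 h2).trans ?_))
  rw [← ENNReal.ofReal_add (by positivity) (by positivity)]
  refine ENNReal.ofReal_le_ofReal ?_
  have e1 : Real.exp (k * q - 11 / 8 * (k * q)) ≤ Real.exp (-(k * q / 3)) :=
    Real.exp_le_exp.2 (by linarith)
  have e2 : Real.exp (0 - 3 / 8 * (k * q)) ≤ Real.exp (-(k * q / 3)) :=
    Real.exp_le_exp.2 (by linarith)
  linarith

/-! ### Symmetrization by random reordering -/

/-- A symmetric learner is a soft learner. -/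
theorem isSoftLearner_of_isSymmetric {X Y : Type*} [MeasurableSpace X] [MeasurableSpace Y]
    {ℓ : Y → Y → ℝ} (hℓ : IsBoundedPseudometric ℓ) {A : Learner X Y} (hA : A.IsMeasurable ℓ)
    (hs : A.IsSymmetric) : IsSoftLearner ℓ fun m S z => ℓ (A m S z.1) z.2 where
  measurable m := hA m
  symm m π S z := by rw [hs]
  nonneg _ _ _ := hℓ.nonneg _ _
  le_one _ _ _ := hℓ.le_one _ _
  le_add _ _ _ _ _ := hℓ.triangle _ _ _
  loss_le m S x y y' := by
    rw [hℓ.symm (A m S x) y]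
    exact hℓ.triangle _ _ _

theorem TransLearns.sum_le {X Y : Type*} {ℓ : Y → Y → ℝ} {H : Set (X → Y)} {A : Learner X Y}
    {q : ℝ} {n : ℕ} (hT : TransLearns ℓ H A q n) {m : ℕ} (hm : n ≤ m + 1)
    (S : Fin (m + 1) → X × Y) (hS : IsRealizableSample H S) :
    ∑ i : Fin (m + 1), ℓ (A m (fun j => S (i.succAbove j)) (S i).1) (S i).2 ≤
      ((m : ℝ) + 1) * q := by
  have h := hT m hm S hS
  have h0 : (0 : ℝ) < (m : ℝ) + 1 := by positivity
  rw [transError, one_div, inv_mul_le_iff₀ h0] at h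
  exact h

/-- The expected loss of `A` after a uniformly random reordering of the sample. -/
noncomputable def shuffledLoss {X Y : Type*} (ℓ : Y → Y → ℝ) (A : Learner X Y) (m : ℕ)
    (S : Fin m → X × Y) (z : X × Y) : ℝ :=
  (m.factorial : ℝ)⁻¹ * ∑ π : Equiv.Perm (Fin m), ℓ (A m (S ∘ π) z.1) z.2

theorem inv_factorial_mul_sum_const (m : ℕ) (c : ℝ) :
    (m.factorial : ℝ)⁻¹ * ∑ _π : Equiv.Perm (Fin m), c = c := by
  have : (m.factorial : ℝ) ≠ 0 := by positivity
  simp [Fintype.card_perm, this]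

theorem inv_factorial_mul_sum_le {m : ℕ} {f g : Equiv.Perm (Fin m) → ℝ} (h : ∀ π, f π ≤ g π) :
    (m.factorial : ℝ)⁻¹ * ∑ π, f π ≤ (m.factorial : ℝ)⁻¹ * ∑ π, g π := by
  gcongr
  exact h _

theorem isSoftLearner_shuffledLoss {X Y : Type*} [MeasurableSpace X] [MeasurableSpace Y]
    {ℓ : Y → Y → ℝ} (hℓ : IsBoundedPseudometric ℓ) {A : Learner X Y} (hA : A.IsMeasurable ℓ) :
    IsSoftLearner ℓ (shuffledLoss ℓ A) where
  measurable m := by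
    have h : ∀ π : Equiv.Perm (Fin m), Measurable fun p : (Fin m → X × Y) × (X × Y) =>
        ℓ (A m (p.1 ∘ π) p.2.1) p.2.2 := fun π =>
      (hA m).comp (by fun_prop : Measurable fun p : (Fin m → X × Y) × (X × Y) =>
        ((fun j => p.1 (π j)), p.2))
    exact (Finset.measurable_sum _ fun π _ => h π).const_mul _
  symm m π S z := by
    unfold shuffledLoss
    congr 1
    exact Fintype.sum_equiv (Equiv.mulLeft π) _ _ fun σ => rfl
  nonneg m S z := mul_nonneg (by positivity) (Finset.sum_nonneg fun _ _ => hℓ.nonneg _ _)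
  le_one m S z := by
    rw [← inv_factorial_mul_sum_const m 1]
    exact inv_factorial_mul_sum_le fun _ => hℓ.le_one _ _
  le_add m S x y y' := by
    rw [← inv_factorial_mul_sum_const m (ℓ y' y), shuffledLoss, shuffledLoss, ← mul_add,
      ← Finset.sum_add_distrib]
    exact inv_factorial_mul_sum_le fun _ => hℓ.triangle _ _ _
  loss_le m S x y y' := by
    rw [← inv_factorial_mul_sum_const m (ℓ y y'), shuffledLoss, shuffledLoss, ← mul_add,
      ← Finset.sum_add_distrib]
    refine inv_factorial_mul_sum_le fun σ => ?_
    rw [hℓ.symm _ y]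
    exact hℓ.triangle _ _ _

/-- A uniformly random permutation of `m + 1` points, seen from index `i`, is a uniformly random
point together with a uniformly random ordering of the other points. -/
theorem sum_perm_succAbove {m : ℕ} (i : Fin (m + 1))
    (G : (Fin m → Fin (m + 1)) → Fin (m + 1) → ℝ) :
    ∑ σ : Equiv.Perm (Fin (m + 1)), G (fun x => σ (i.succAbove x)) (σ i) =
      ∑ j, ∑ π : Equiv.Perm (Fin m), G (fun x => j.succAbove (π x)) j := by
  rw [← Fintype.sum_prod_type']
  have hb : Function.Bijective fun p : Fin (m + 1) × Equiv.Perm (Fin m) => permInsert i p.1 p.2 := by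
    rw [Fintype.bijective_iff_injective_and_card]
    refine ⟨fun p p' h => ?_, ?_⟩
    · have h1 : p.1 = p'.1 := by simpa using congrArg (fun σ : Equiv.Perm _ => σ i) h
      refine Prod.ext h1 (Equiv.ext fun x => ?_)
      have h2 := congrArg (fun σ : Equiv.Perm _ => σ (i.succAbove x)) h
      simp only [permInsert_succAbove, h1] at h2
      exact Fin.succAbove_right_injective h2
    · simp [Fintype.card_perm, Nat.factorial_succ]
  refine (hb.sum_comp _).symm.trans (Finset.sum_congr rfl fun p _ => ?_)
  simp

/-- The leave-one-out sum of the shuffled learner is the average, over all reorderings of the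
sample, of that of `A`, and every reordering of a realizable sample is realizable. -/
theorem TransLearns.softTransLearns_shuffledLoss {X Y : Type*} {ℓ : Y → Y → ℝ} {H : Set (X → Y)}
    {A : Learner X Y} {q : ℝ} {n : ℕ} (hT : TransLearns ℓ H A q n) :
    SoftTransLearns H (shuffledLoss ℓ A) q n := by
  intro m hm S hS
  set G : (Fin m → Fin (m + 1)) → Fin (m + 1) → ℝ := fun τ j =>
    ℓ (A m (fun x => S (τ x)) (S j).1) (S j).2
  have h1 : ∑ i, shuffledLoss ℓ A m (fun j => S (Fin.succAbove i j)) (S i) =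
      (m.factorial : ℝ)⁻¹ * ∑ j, ∑ π : Equiv.Perm (Fin m), G (fun x => j.succAbove (π x)) j := by
    rw [Finset.mul_sum]
    rfl
  -- Each of the `m + 1` positions `i` contributes the same double sum.
  have h2 : ((m : ℝ) + 1) * ∑ j, ∑ π : Equiv.Perm (Fin m), G (fun x => j.succAbove (π x)) j =
      ∑ σ : Equiv.Perm (Fin (m + 1)), ∑ i, G (fun x => σ (i.succAbove x)) (σ i) := by
    rw [Finset.sum_comm (s := Finset.univ (α := Equiv.Perm (Fin (m + 1)))),
      Finset.sum_congr rfl fun i _ => sum_perm_succAbove i G]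
    simp
  have h3 : ∑ σ : Equiv.Perm (Fin (m + 1)), ∑ i, G (fun x => σ (i.succAbove x)) (σ i) ≤
      ∑ σ : Equiv.Perm (Fin (m + 1)), ((m : ℝ) + 1) * q := by
    refine Finset.sum_le_sum fun σ _ => ?_
    obtain ⟨h, hH, hh⟩ := hS
    exact hT.sum_le (hm.trans (Nat.le_succ m)) (fun x => S (σ x)) ⟨h, hH, fun i => hh (σ i)⟩
  rw [← h2] at h3
  simp only [Finset.sum_const, Finset.card_univ, Fintype.card_perm, Fintype.card_fin,
    nsmul_eq_mul, Nat.factorial_succ] at h3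
  push_cast at h3
  have h0 : (0 : ℝ) < (m : ℝ) + 1 := by positivity
  rw [h1, inv_mul_le_iff₀ (by positivity)]
  refine le_of_mul_le_mul_left (h3.trans_eq ?_) h0
  ring

/-! ### Risk of near-medians -/

/-- The total loss of the label `u` against the predictions at `x` learned from the samples `P i`. -/
noncomputable def totalLoss {X Y : Type*} (Λ : (m : ℕ) → (Fin m → X × Y) → X × Y → ℝ) {k : ℕ}
    {N : Fin k → ℕ} (P : (i : Fin k) → Fin (N i) → X × Y) (x : X) (u : Y) : ℝ :=
  ∑ i, Λ (N i) (P i) (x, u)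

/-- A predictor that nearly minimizes the total loss to several predictions has risk at most
about twice their average risk. -/
theorem risk_le_of_totalLoss_le {X Y : Type*} [MeasurableSpace X] [MeasurableSpace Y]
    {ℓ : Y → Y → ℝ} {Λ : (m : ℕ) → (Fin m → X × Y) → X × Y → ℝ} (hΛ : IsSoftLearner ℓ Λ)
    (D : Measure (X × Y)) [IsProbabilityMeasure D] {k : ℕ} (hk : 0 < k) {η : ℝ} (hη : 0 ≤ η)
    {N : Fin k → ℕ} (P : (i : Fin k) → Fin (N i) → X × Y) (b : X → Y)
    (hb : ∀ x u, totalLoss Λ P x (b x) ≤ totalLoss Λ P x u + k * η) :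
    risk ℓ D b ≤ ENNReal.ofReal (2 / k * ∑ i, ∫ z, Λ (N i) (P i) z ∂D + η) := by
  have hk' : (0 : ℝ) < k := by exact_mod_cast hk
  set F : X × Y → ℝ := fun z => 2 / k * ∑ i, Λ (N i) (P i) z + η with hF
  have hm : ∀ i : Fin k, Measurable (Λ (N i) (P i)) := fun i =>
    (hΛ.measurable _).comp measurable_prodMk_left
  have hFm : Measurable F := ((Finset.measurable_sum _ fun i _ => hm i).const_mul _).add_const _
  have hi : Integrable (fun z => ∑ i, Λ (N i) (P i) z) D :=
    integrable_finsetSum _ fun i _ => integrable_soft hΛ D _ _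
  have hFi : Integrable F D := (hi.const_mul _).add (integrable_const η)
  have hF0 : ∀ z, 0 ≤ F z := fun z =>
    add_nonneg (mul_nonneg (by positivity) (Finset.sum_nonneg fun i _ => hΛ.nonneg _ _ _)) hη
  have hle : ∀ z : X × Y, ℓ (b z.1) z.2 ≤ F z := by
    rintro ⟨x, y⟩
    -- Go from `b x` to `y` through each prediction; near-minimality against the true label `y` then
    -- bounds the first sum by the second.
    have h1 : k * ℓ (b x) y ≤ totalLoss Λ P x (b x) + totalLoss Λ P x y := by
      rw [totalLoss, totalLoss, ← Finset.sum_add_distrib]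
      calc _ = ∑ _i : Fin k, ℓ (b x) y := by simp
        _ ≤ _ := Finset.sum_le_sum fun i _ => hΛ.loss_le _ _ _ _ _
    have h2 := hb x y
    have h3 : F (x, y) = (2 * totalLoss Λ P x y + k * η) / k := by
      simp only [hF, totalLoss]
      field_simp
    rw [h3, le_div_iff₀ hk']
    linarith
  refine le_trans (b := ∫⁻ z, ENNReal.ofReal (F z) ∂D)
    (iInf_le_of_le _ (iInf_le_of_le hFm.ennreal_ofReal
      (iInf_le_of_le (fun z => ENNReal.ofReal_le_ofReal (hle z)) le_rfl))) ?_
  rw [← ofReal_integral_eq_lintegral_ofReal hFi (ae_of_all _ hF0)]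
  refine ENNReal.ofReal_le_ofReal (le_of_eq ?_)
  rw [hF, integral_add (hi.const_mul _) (integrable_const η), integral_const_mul,
    integral_finsetSum _ fun i _ => integrable_soft hΛ D _ _]
  simp

/-- A slack of `ε / 8` leaves `7 / 8 * ε < 2 / k * ∑ r_i`, which is the threshold of
`measure_sum_risk_le` at `q = ε / 8`. -/
theorem lt_sum_risk_of_lt_risk {X Y : Type*} [MeasurableSpace X] [MeasurableSpace Y]
    {ℓ : Y → Y → ℝ} {Λ : (m : ℕ) → (Fin m → X × Y) → X × Y → ℝ} (hΛ : IsSoftLearner ℓ Λ)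
    (D : Measure (X × Y)) [IsProbabilityMeasure D] {k : ℕ} (hk : 0 < k) {ε : ℝ} (hε : 0 ≤ ε)
    {N : Fin k → ℕ} (P : (i : Fin k) → Fin (N i) → X × Y) (b : X → Y)
    (hb : ∀ x u, totalLoss Λ P x (b x) ≤ totalLoss Λ P x u + k * (ε / 8))
    (h : ENNReal.ofReal ε < risk ℓ D b) :
    7 / 2 * (k * (ε / 8)) < ∑ i, ∫ z, Λ (N i) (P i) z ∂D := by
  have hk' : (0 : ℝ) < k := by exact_mod_cast hk
  have h1 := h.trans_le (risk_le_of_totalLoss_le hΛ D hk (by positivity) P b hb)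
  have h2 := (ENNReal.ofReal_lt_ofReal_iff_of_nonneg hε).1 h1
  have h3 : ε - ε / 8 < (2 * ∑ i, ∫ z, Λ (N i) (P i) z ∂D) / k := by
    rw [mul_div_right_comm]
    linarith
  rw [lt_div_iff₀ hk'] at h3
  linarith

theorem two_mul_exp_le {ε δ : ℝ} (hε : 0 < ε) (hδ : 0 < δ) {k : ℕ}
    (hk : 24 / ε * Real.log (2 / δ) ≤ k) : 2 * Real.exp (-(k * (ε / 8) / 3)) ≤ δ := by
  have h1 : Real.log (2 / δ) ≤ k * (ε / 8) / 3 := by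
    rw [div_mul_eq_mul_div, div_le_iff₀ hε] at hk
    linarith
  have h2 : Real.exp (-(k * (ε / 8) / 3)) ≤ Real.exp (-Real.log (2 / δ)) :=
    Real.exp_le_exp.2 (by linarith)
  rw [Real.exp_neg (Real.log _), Real.exp_log (by positivity)] at h2
  calc _ ≤ 2 * (2 / δ)⁻¹ := by gcongr
    _ = δ := by field_simp

theorem log_sample_bound_pos {ε δ : ℝ} (hε : 0 < ε) (hδ : 0 < δ) (hδ1 : δ < 1) :
    0 < 24 / ε * Real.log (2 / δ) :=
  mul_pos (by positivity) (Real.log_pos (by rw [lt_div_iff₀ hδ]; linarith))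

/-! ### PAC learners from near-medians, and measurable selection -/

/-- The prefixes of sizes `n, …, n + K` of a sample of size `n + K`. -/
def closedPrefix {X Y : Type*} {n K : ℕ} (T : Fin (n + K) → X × Y) (i : Fin (K + 1)) :
    Fin (n + i) → X × Y :=
  fun j => T (Fin.castLE (Nat.add_le_add_left (Nat.lt_succ_iff.1 i.isLt) n) j)

/-- The last point of the sample is not used by any of the prefixes, and can be dropped. -/
theorem measure_sum_risk_closedPrefix_le {X Y : Type*} [MeasurableSpace X] [MeasurableSpace Y]
    {ℓ : Y → Y → ℝ} {H : Set (X → Y)} {Λ : (m : ℕ) → (Fin m → X × Y) → X × Y → ℝ}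
    (hΛ : IsSoftLearner ℓ Λ) {q : ℝ} (hq : 0 ≤ q) {n : ℕ} (hT : SoftTransLearns H Λ q n)
    {D : Measure (X × Y)} [IsProbabilityMeasure D] (hD : IsRealizableDist H D) (K : ℕ) :
    (Measure.pi fun _ : Fin (n + K) => D)
      {T | 7 / 2 * ((K + 1 : ℕ) * q) <
        ∑ i : Fin (K + 1), ∫ z, Λ (n + i) (closedPrefix T i) z ∂D} ≤
      ENNReal.ofReal (2 * Real.exp (-((K + 1 : ℕ) * q / 3))) := by
  have hmp : MeasurePreserving
      (fun (S : Fin (n + K + 1) → X × Y) (j : Fin (n + K)) => S j.castSucc)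
      (Measure.pi fun _ => D) (Measure.pi fun _ => D) := by
    have h := (measurePreserving_snd (μ := D) (ν := Measure.pi fun _ : Fin (n + K) => D)).comp
      (measurePreserving_piFinSuccAbove (fun _ : Fin (n + K + 1) => D) (Fin.last (n + K)))
    convert h using 1
    funext S j
    simp [MeasurableEquiv.piFinSuccAbove, Fin.insertNthEquiv, Fin.init]
  have hms : MeasurableSet {T : Fin (n + K) → X × Y | 7 / 2 * ((K + 1 : ℕ) * q) <
      ∑ i : Fin (K + 1), ∫ z, Λ (n + i) (closedPrefix T i) z ∂D} := by
    refine measurableSet_lt measurable_const (Finset.measurable_sum _ fun i _ => ?_)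
    exact (measurable_integral_soft hΛ D (n + i)).comp
      (measurable_pi_lambda _ fun _ => measurable_pi_apply _)
  rw [← hmp.measure_preimage hms.nullMeasurableSet]
  exact measure_sum_risk_le hΛ hq hT hD (K + 1)

/-- Near-medians of the predictions learned from nested prefixes form a PAC learner. -/
theorem exists_pacLearner {X Y : Type*} [MeasurableSpace X] [MeasurableSpace Y]
    {ℓ : Y → Y → ℝ} {H : Set (X → Y)} {Λ : (m : ℕ) → (Fin m → X × Y) → X × Y → ℝ}
    (hΛ : IsSoftLearner ℓ Λ) {ε δ : ℝ} (hε : 0 < ε) (hδ : 0 < δ) {n K : ℕ}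
    (hT : SoftTransLearns H Λ (ε / 8) n) (hK : 24 / ε * Real.log (2 / δ) ≤ (K + 1 : ℕ))
    (Q : (m : ℕ) → ((Fin m → X × Y) → X → Y) → Prop) (A : Learner X Y) (hA : ∀ m, Q m (A m))
    (hQ : ∀ n', ∃ b, Q (n' + K) b ∧ ∀ T x u, totalLoss Λ (closedPrefix T) x (b T x) ≤
      totalLoss Λ (closedPrefix T) x u + (K + 1 : ℕ) * (ε / 8)) :
    ∃ B : Learner X Y, (∀ m, Q m (B m)) ∧ PACLearns ℓ H B ε δ (n + K) := by
  -- The predicate `Q` carries a side condition on the learner at each sample size: nothing, or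
  -- measurability.
  have key : ∀ m, ∃ b : (Fin m → X × Y) → X → Y, Q m b ∧ (n + K ≤ m →
      ∀ D : Measure (X × Y), IsProbabilityMeasure D → IsRealizableDist H D →
        (Measure.pi fun _ : Fin m => D) {S | ENNReal.ofReal ε < risk ℓ D (b S)} ≤
          ENNReal.ofReal δ) := by
    intro m
    by_cases hm : n + K ≤ m
    -- Larger samples lengthen the shortest prefix; the number of predictors stays `K + 1`.
    · obtain ⟨n', rfl⟩ : ∃ n', m = n' + K := ⟨m - K, by omega⟩
      obtain ⟨b, hb, hb'⟩ := hQ n'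
      refine ⟨b, hb, fun _ D hDp hD => ?_⟩
      have hT' : SoftTransLearns H Λ (ε / 8) n' := fun m' hm' => hT m' (by omega)
      exact (measure_mono fun S hS => lt_sum_risk_of_lt_risk hΛ D K.succ_pos hε.le (closedPrefix S)
          (b S) (hb' S) hS).trans
        ((measure_sum_risk_closedPrefix_le hΛ (by positivity) hT' hD K).trans
          (ENNReal.ofReal_le_ofReal (two_mul_exp_le hε hδ hK)))
    -- Nothing is required at small sizes, and `A` only supplies some map with property `Q`.
    · exact ⟨A m, hA m, fun h => absurd h hm⟩
  choose B hB hB' using key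
  exact ⟨B, hB, fun m hm D => hB' m hm D⟩

theorem totalLoss_nonneg {X Y : Type*} [MeasurableSpace X] [MeasurableSpace Y]
    {ℓ : Y → Y → ℝ} {Λ : (m : ℕ) → (Fin m → X × Y) → X × Y → ℝ} (hΛ : IsSoftLearner ℓ Λ) {k : ℕ}
    {N : Fin k → ℕ} (P : (i : Fin k) → Fin (N i) → X × Y) (x : X) (u : Y) :
    0 ≤ totalLoss Λ P x u :=
  Finset.sum_nonneg fun _ _ => hΛ.nonneg _ _ _

theorem exists_totalLoss_le {X Y : Type*} [MeasurableSpace X] [MeasurableSpace Y] [Nonempty Y]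
    {ℓ : Y → Y → ℝ} {Λ : (m : ℕ) → (Fin m → X × Y) → X × Y → ℝ} (hΛ : IsSoftLearner ℓ Λ) {k : ℕ}
    {N : Fin k → ℕ} (P : (i : Fin k) → Fin (N i) → X × Y) (x : X) {κ : ℝ} (hκ : 0 < κ) :
    ∃ v, ∀ u, totalLoss Λ P x v ≤ totalLoss Λ P x u + κ := by
  have hbd : BddBelow (Set.range fun u => totalLoss Λ P x u) :=
    ⟨0, by rintro _ ⟨u, rfl⟩; exact totalLoss_nonneg hΛ P x u⟩
  obtain ⟨v, hv⟩ := exists_lt_of_ciInf_lt (lt_add_of_pos_right (⨅ u, totalLoss Λ P x u) hκ)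
  exact ⟨v, fun u => hv.le.trans (by linarith [ciInf_le hbd u])⟩

/-- For a separable loss, near-minimizers of the total loss can be chosen measurably: take the
first near-minimizer in a dense sequence. -/
theorem exists_measurable_totalLoss_le {X Y Ω : Type*} [MeasurableSpace X] [MeasurableSpace Y]
    [MeasurableSpace Ω] [Nonempty Y] {ℓ : Y → Y → ℝ} (hℓ : IsBoundedPseudometric ℓ)
    (hmeas : Measurable (Function.uncurry ℓ)) (hsep : IsSeparableLoss ℓ)
    {Λ : (m : ℕ) → (Fin m → X × Y) → X × Y → ℝ} (hΛ : IsSoftLearner ℓ Λ) {k : ℕ}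
    {N : Fin k → ℕ} (P : Ω → (i : Fin k) → Fin (N i) → X × Y)
    (hP : ∀ i, Measurable fun ω => P ω i) {κ : ℝ} (hκ : 0 < κ) :
    ∃ b : Ω → X → Y, (Measurable fun p : Ω × (X × Y) => ℓ (b p.1 p.2.1) p.2.2) ∧
      ∀ ω x u, totalLoss Λ (P ω) x (b ω x) ≤ totalLoss Λ (P ω) x u + κ := by
  classical
  obtain ⟨t, ht, hd⟩ := hsep
  have hne : t.Nonempty := by
    obtain ⟨v, hv, -⟩ := hd (Classical.arbitrary Y) 1 one_pos
    exact ⟨v, hv⟩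
  obtain ⟨v, rfl⟩ := ht.exists_eq_range hne
  set Φ : ℕ → Ω × X → ℝ := fun j p => totalLoss Λ (P p.1) p.2 (v j)
  have hΦm : ∀ j, Measurable (Φ j) := fun j =>
    Finset.measurable_sum _ fun i _ => (hΛ.measurable (N i)).comp
      (((hP i).comp measurable_fst).prodMk (measurable_snd.prodMk measurable_const))
  have hbd : ∀ p, BddBelow (Set.range fun j => Φ j p) := fun p =>
    ⟨0, by rintro _ ⟨u, rfl⟩; exact totalLoss_nonneg hΛ _ _ _⟩
  have hex : ∀ p, ∃ j, Φ j p ≤ (⨅ j', Φ j' p) + κ := fun p => by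
    obtain ⟨j, hj⟩ := exists_lt_of_ciInf_lt (lt_add_of_pos_right (⨅ j', Φ j' p) hκ)
    exact ⟨j, hj.le⟩
  have hJ : Measurable fun p => Nat.find (hex p) :=
    measurable_find hex fun j => measurableSet_le (hΦm j)
      ((Measurable.iInf fun j' => hΦm j').add_const κ)
  refine ⟨fun ω x => v (Nat.find (hex (ω, x))), ?_, fun ω x u => ?_⟩
  · have h1 : Measurable fun p : ℕ × Y => ℓ (v p.1) p.2 :=
      measurable_from_prod_countable_right fun j =>
        hmeas.comp (measurable_prodMk_left (x := v j))
    have h2 : Measurable fun p : Ω × (X × Y) => (Nat.find (hex (p.1, p.2.1)), p.2.2) :=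
      (hJ.comp (measurable_fst.prodMk (measurable_fst.comp measurable_snd))).prodMk
        (measurable_snd.comp measurable_snd)
    exact h1.comp h2
  · refine (Nat.find_spec (hex (ω, x))).trans (add_le_add_left ?_ κ)
    refine le_of_forall_pos_le_add fun τ hτ => ?_
    -- Replacing `u` by `v j` costs at most `k * ℓ (v j) u`; the denominator `k + 1` also covers `k
    -- = 0`.
    obtain ⟨_, ⟨j, rfl⟩, hj⟩ := hd u (τ / (k + 1)) (by positivity)
    refine (ciInf_le (hbd (ω, x)) j).trans ?_
    have h1 : Φ j (ω, x) ≤ totalLoss Λ (P ω) x u + k * ℓ (v j) u := by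
      calc _ ≤ ∑ i, (Λ (N i) (P ω i) (x, u) + ℓ (v j) u) := Finset.sum_le_sum fun i _ => by
            rw [hℓ.symm (v j) u]
            exact hΛ.le_add _ _ _ _ _
        _ = _ := by simp [Finset.sum_add_distrib, totalLoss]
    rw [lt_div_iff₀ (by positivity)] at hj
    have := hℓ.nonneg (v j) u
    linarith

/-- Sample sizes are integers, so the additive term must be rounded down. This is possible because
`⌊c⌋₊` extra points yield `⌊c⌋₊ + 1 > c` prefixes. -/
theorem pacSampleComplexity_le {X Y : Type*} [MeasurableSpace X] [MeasurableSpace Y]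
    {ℓ : Y → Y → ℝ} {H : Set (X → Y)} {𝒜 ℬ : Set (Learner X Y)} {ε ε' δ c : ℝ} (hc : 0 ≤ c)
    (h : ∀ A ∈ 𝒜, ∀ n, TransLearns ℓ H A ε' n → ∃ B ∈ ℬ, PACLearns ℓ H B ε δ (n + ⌊c⌋₊)) :
    ((pacSampleComplexity ℬ ℓ H ε δ : ℕ∞) : ℝ≥0∞) ≤
      ((transSampleComplexity 𝒜 ℓ H ε' : ℕ∞) : ℝ≥0∞) + ENNReal.ofReal c := by
  have h1 : pacSampleComplexity ℬ ℓ H ε δ ≤ transSampleComplexity 𝒜 ℓ H ε' + (⌊c⌋₊ : ℕ∞) := by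
    rw [← tsub_le_iff_right]
    refine le_iInf fun n => le_iInf fun ⟨A, hA, hT⟩ => ?_
    rw [tsub_le_iff_right]
    exact iInf_le_of_le (n + ⌊c⌋₊) (iInf_le_of_le (h A hA n hT) (by simp))
  refine (ENat.toENNReal_le.2 h1).trans ?_
  rw [ENat.toENNReal_add]
  gcongr
  rw [ENat.toENNReal_coe, ← ENNReal.ofReal_natCast]
  exact ENNReal.ofReal_le_ofReal (Nat.floor_le hc)

/-- With no labels there are no near-medians to choose, but also no probability measure to learn
from. -/
theorem pacLearns_of_isEmpty {X Y : Type*} [MeasurableSpace X] [MeasurableSpace Y] [IsEmpty Y]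
    {ℓ : Y → Y → ℝ} {H : Set (X → Y)} (A : Learner X Y) (ε δ : ℝ) (n : ℕ) :
    PACLearns ℓ H A ε δ n := by
  intro m _ D hD
  obtain ⟨z⟩ := nonempty_of_isProbabilityMeasure D
  exact isEmptyElim z.2

end RealizableLearning

theorem mainTheorem6 {X Y : Type*} [MeasurableSpace X] [MeasurableSpace Y]
    (ℓ : Y → Y → ℝ) (hℓ : RealizableLearning.IsBoundedPseudometric ℓ)
    (hmeas : Measurable (Function.uncurry ℓ)) (H : Set (X → Y))
    (ε δ : ℝ) (hε : 0 < ε) (hδ : 0 < δ) (hδ1 : δ < 1) :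
    -- the bound, for an arbitrary label space
    ((RealizableLearning.pacSampleComplexity Set.univ ℓ H ε δ : ℕ∞) : ℝ≥0∞) ≤
        ((RealizableLearning.transSampleComplexity
          {A : RealizableLearning.Learner X Y | A.IsMeasurable ℓ} ℓ H (ε / 8) : ℕ∞) : ℝ≥0∞) +
        ENNReal.ofReal (24 / ε * Real.log (2 / δ)) ∧
    -- for a separable label space, the PAC learner can be taken measurable
    (RealizableLearning.IsSeparableLoss ℓ →
      ((RealizableLearning.pacSampleComplexity
          {A : RealizableLearning.Learner X Y | A.IsMeasurable ℓ} ℓ H ε δ : ℕ∞) : ℝ≥0∞) ≤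
        ((RealizableLearning.transSampleComplexity
          {A : RealizableLearning.Learner X Y | A.IsMeasurable ℓ} ℓ H (ε / 8) : ℕ∞) : ℝ≥0∞) +
        ENNReal.ofReal (24 / ε * Real.log (2 / δ))) ∧
    -- the bound is achieved by medians of a transductive learner trained on nested prefixes
    (∀ (A : RealizableLearning.Learner X Y) (n k : ℕ)
        (B : (Fin (n + k) → X × Y) → X → Y) (D : Measure (X × Y)),
      A.IsMeasurable ℓ → A.IsSymmetric →
      RealizableLearning.TransLearns ℓ H A (ε / 8) n →
      24 / ε * Real.log (2 / δ) ≤ (k : ℝ) →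
      RealizableLearning.IsMedianOfPrefixes ℓ A n k B →
      IsProbabilityMeasure D → RealizableLearning.IsRealizableDist H D →
      (Measure.pi fun _ : Fin (n + k) => D)
        {S | ENNReal.ofReal ε < RealizableLearning.risk ℓ D (B S)} ≤ ENNReal.ofReal δ) := by
  have hc := RealizableLearning.log_sample_bound_pos hε hδ hδ1
  have hK : 24 / ε * Real.log (2 / δ) ≤ (⌊24 / ε * Real.log (2 / δ)⌋₊ + 1 : ℕ) := by
    push_cast
    exact (Nat.lt_floor_add_one _).le
  refine ⟨RealizableLearning.pacSampleComplexity_le hc.le fun A hA n hT => ?_,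
    fun hsep => RealizableLearning.pacSampleComplexity_le hc.le fun A hA n hT => ?_,
    fun A n k B D hA hs hT hk hB hDp hD => ?_⟩
  · rcases isEmpty_or_nonempty Y with hY | hY
    · exact ⟨A, Set.mem_univ _, RealizableLearning.pacLearns_of_isEmpty A _ _ _⟩
    have hΛ := RealizableLearning.isSoftLearner_shuffledLoss hℓ hA
    obtain ⟨B, -, hB⟩ := RealizableLearning.exists_pacLearner hΛ hε hδ
      hT.softTransLearns_shuffledLoss hK (fun _ _ => True) A (fun _ => trivial) fun n' => by
        choose b hb using fun (T : Fin (n' + ⌊24 / ε * Real.log (2 / δ)⌋₊) → X × Y) (x : X) =>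
          RealizableLearning.exists_totalLoss_le hΛ (RealizableLearning.closedPrefix T) x
            (κ := (⌊24 / ε * Real.log (2 / δ)⌋₊ + 1 : ℕ) * (ε / 8)) (by positivity)
        exact ⟨b, trivial, hb⟩
    exact ⟨B, Set.mem_univ _, hB⟩
  · rcases isEmpty_or_nonempty Y with hY | hY
    · exact ⟨A, hA, RealizableLearning.pacLearns_of_isEmpty A _ _ _⟩
    have hΛ := RealizableLearning.isSoftLearner_shuffledLoss hℓ hA
    exact RealizableLearning.exists_pacLearner hΛ hε hδ hT.softTransLearns_shuffledLoss hK
      (fun m b => Measurable fun p : (Fin m → X × Y) × (X × Y) => ℓ (b p.1 p.2.1) p.2.2) A hA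
      fun n' => RealizableLearning.exists_measurable_totalLoss_le hℓ hmeas hsep hΛ
        RealizableLearning.closedPrefix
        (fun i => measurable_pi_lambda _ fun _ => measurable_pi_apply _) (by positivity)
  · have hk0 : (0 : ℝ) < k := hc.trans_le hk
    have hΛ := RealizableLearning.isSoftLearner_of_isSymmetric hℓ hA hs
    have hT' : RealizableLearning.SoftTransLearns H
        (fun m (S : Fin m → X × Y) z => ℓ (A m S z.1) z.2) (ε / 8) n :=
      fun m hm S hS => hT.sum_le (hm.trans (Nat.le_succ m)) S hS
    refine (measure_mono fun S hS => RealizableLearning.lt_sum_risk_of_lt_risk hΛ D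
      (by exact_mod_cast hk0) hε.le (RealizableLearning.samplePrefix S) (B S)
      -- An exact median leaves the allowed slack unused.
      (fun x u => (hB S x u).trans (le_add_of_nonneg_right (by positivity))) hS).trans
      ((RealizableLearning.measure_sum_risk_le hΛ (by positivity) hT' hD k).trans
        (ENNReal.ofReal_le_ofReal (RealizableLearning.two_mul_exp_le hε hδ hk)))
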